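/- Let $m$ be normalised Lebesgue measure on the unit circle $\mathbb T$ and write $L^p=L^p(\mathbb T)$. Let $H^2_+\subset L^2$ be the Hardy space, i.e. the functions in $L^2$ whose Fourier coefficients of negative index vanish, let $H^2_-=(H^2_+)^\perp$, and let $P^\pm$ be the orthogonal projections of $L^2$ onto $H^2_\pm$. Let $H^\infty$ be the space of functions in $L^\infty$ whose Fourier coefficients of negative index vanish, identified as usual with bounded analytic functions on the unit disc, and let $\overline{H^\infty}$ be the space of their complex conjugates. For $a,b\in L^\infty$ put $S_{a,b}f=aP^+f+bP^-f$ for $f\in L^2$, and let $$\ker^+_{a,b}=P^+(\ker S_{a,b}).$$ A function $f\in H^\infty$ is outer if $\log|f|\in L^1$ and, for some constant $c$ with $|c|=1$, $$f(w)=c\exp\Big(\int_{\mathbb T}\frac{z+w}{z-w}\,\log|f(z)|\,dm(z)\Big)\qquad\text{for all } |w|<1 .$$ It is inner if $|f|=1$ a.e. on $\mathbb T$, and it has a non-constant inner factor if $f=\theta g$ with $\theta$ a non-constant inner function and $g\in H^\infty$. Let $a,b\in L^\infty$ be such that $a$, $b$ and $a-b$ are nonzero a.e. on $\mathbb T$,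 and let $h_-\in\overline{H^\infty}$. Then: (i) $\ker^+_{a,bh_-}\subseteq\ker^+_{a,b}\subseteq\ker^+_{ah_-,b}$. (ii) If $\overline{h_-}$ is outer, then (a) $\ker^+_{a,bh_-}=\ker^+_{a,b}$ whenever $\dfrac{a}{bh_-}\in L^\infty$; (b) $\ker^+_{ah_-,b}=\ker^+_{a,b}$ whenever $\dfrac ab\in L^\infty$. (iii) If $\overline{h_-}$ has a non-constant inner factor, then $\ker^+_{a,bh_-}\subsetneq\ker^+_{a,b}$ provided $\ker^+_{a,b}\neq\{0\}$, and $\ker^+_{a,b}\subsetneq\ker^+_{ah_-,b}$ provided $\ker^+_{ah_-,b}\neq\{0\}$. In particular both inclusions in (i) are strict if $\ker^+_{a,b}\ne\{0\}$. -/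

import Mathlib

open MeasureTheory AddCircle
open scoped ENNReal

noncomputable section

namespace PairedKernel

/-- Normalised Lebesgue measure on the unit circle. The circle is `ℝ / ℤ`, a point `t` of which
stands for `exp (2 π i t)`; thus `fourier n` is the function `z ↦ z ^ n`. -/
abbrev circleMeasure : Measure UnitAddCircle := haarAddCircle

/-- The complex space `L²` of the circle. -/
abbrev L2 : Type := Lp ℂ 2 circleMeasure

/-- The complex space `L^∞` of the circle. -/
abbrev Linf : Type := Lp ℂ ∞ circleMeasure

theorem fourierCoeff_eq_repr (f : L2) (n : ℤ) :
    fourierCoeff (f : UnitAddCircle → ℂ) n = fourierBasis.repr f n :=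
  (fourierBasis_repr f n).symm

/-- The Hardy space `H²₊`: the functions in `L²` whose Fourier coefficients of negative index
vanish. -/
def H2 : Submodule ℂ L2 where
  carrier := {f | ∀ n : ℤ, n < 0 → fourierCoeff (f : UnitAddCircle → ℂ) n = 0}
  add_mem' := by
    intro f g hf hg n hn
    have h1 := hf n hn
    have h2 := hg n hn
    rw [fourierCoeff_eq_repr] at *
    simp [h1, h2]
  zero_mem' := by
    intro n _
    rw [fourierCoeff_eq_repr]
    simp
  smul_mem' := by
    intro c f hf n hn
    have h1 := hf n hn
    rw [fourierCoeff_eq_repr] at *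
    simp [h1]

theorem isClosed_H2 : IsClosed (H2 : Set L2) := by
  have h : (H2 : Set L2) =
      ⋂ (n : ℤ) (_ : n < 0), {f : L2 | inner ℂ (fourierBasis (T := 1) n) f = (0 : ℂ)} := by
    ext f
    simp only [Set.mem_iInter, Set.mem_ofPred_eq]
    refine forall₂_congr fun n _ => ?_
    rw [fourierCoeff_eq_repr, HilbertBasis.repr_apply_apply]
  rw [h]
  refine isClosed_iInter fun n => isClosed_iInter fun _ => ?_
  exact isClosed_eq (continuous_const.inner continuous_id) continuous_const

instance : CompleteSpace H2 := isClosed_H2.completeSpace_coe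

/-- The orthogonal projection `P⁺` of `L²` onto `H²₊`. -/
def projPlus : L2 →L[ℂ] L2 := H2.starProjection

/-- The orthogonal projection `P⁻` of `L²` onto `H²₋`, the orthogonal complement of `H²₊`. -/
def projMinus : L2 →L[ℂ] L2 := H2ᗮ.starProjection

/-- The operator of multiplication by `a ∈ L^∞` on `L²`. -/
def mulOp (a : Linf) : L2 →L[ℂ] L2 :=
  (ContinuousLinearMap.mul ℂ ℂ).holderL circleMeasure ∞ 2 2 a

/-- The pointwise product of two elements of `L^∞`. -/
def mulInf (a b : Linf) : Linf :=
  (ContinuousLinearMap.mul ℂ ℂ).holder ∞ a b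

/-- The paired operator `S_{a,b} f = a P⁺ f + b P⁻ f` on `L²`. -/
def pairedOp (a b : Linf) : L2 →L[ℂ] L2 :=
  mulOp a ∘L projPlus + mulOp b ∘L projMinus

/-- The paired kernel `ker_{a,b}`, the kernel of `S_{a,b}`. -/
def pairedKer (a b : Linf) : Submodule ℂ L2 := (pairedOp a b).ker

/-- The projected paired kernel `ker⁺_{a,b} = P⁺ ker_{a,b}`. -/
def projKerPlus (a b : Linf) : Submodule ℂ L2 :=
  (pairedKer a b).map (projPlus : L2 →ₗ[ℂ] L2)

/-- The symbol pair `(a, b)` is nondegenerate: `a`, `b` and `a - b` are nonzero almost everywhere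
on the circle. -/
def Nondegenerate (a b : Linf) : Prop :=
  (∀ᵐ t ∂circleMeasure, a t ≠ 0) ∧ (∀ᵐ t ∂circleMeasure, b t ≠ 0) ∧
    ∀ᵐ t ∂circleMeasure, a t - b t ≠ 0

/-- The algebra `H^∞` as a set of boundary functions: the elements of `L^∞` whose Fourier
coefficients of negative index vanish. -/
def Hinf : Set Linf :=
  {f | ∀ n : ℤ, n < 0 → fourierCoeff (f : UnitAddCircle → ℂ) n = 0}

/-- The analytic extension to the open unit disc of an element of `H^∞`: the power series whose
coefficients are the Fourier coefficients. These are bounded, so the series converges for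
`‖w‖ < 1`. -/
def discExt (f : Linf) (w : ℂ) : ℂ :=
  ∑' n : ℕ, fourierCoeff (f : UnitAddCircle → ℂ) n * w ^ n

/-- Outer functions in `H^∞`: those `f` with `log |f|` integrable on the circle and
`f w = c * exp (∫ (z + w) / (z - w) * log |f z| dm z)` on the open unit disc, for some constant `c`
of modulus one. -/
def IsOuter (f : Linf) : Prop :=
  f ∈ Hinf ∧ Integrable (fun t => Real.log ‖f t‖) circleMeasure ∧
    ∃ c : ℂ, ‖c‖ = 1 ∧ ∀ w : ℂ, ‖w‖ < 1 →
      discExt f w = c * Complex.exp (∫ t : UnitAddCircle,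
        (fourier 1 t + w) / (fourier 1 t - w) * (Real.log ‖f t‖ : ℂ) ∂circleMeasure)

/-- Inner functions: elements of `H^∞` of modulus one almost everywhere on the circle. -/
def IsInner (f : Linf) : Prop :=
  f ∈ Hinf ∧ ∀ᵐ t ∂circleMeasure, ‖f t‖ = 1

/-- An element of `L^∞` is constant if it is almost everywhere equal to a constant. -/
def IsConst (f : Linf) : Prop :=
  ∃ c : ℂ, ∀ᵐ t ∂circleMeasure, f t = c

/-- `f` has a non-constant inner factor: `f = θ g` with `θ` inner and not constant and
`g ∈ H^∞`. -/
def HasNonconstInnerFactor (f : Linf) : Prop :=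
  ∃ θ g : Linf, IsInner θ ∧ ¬ IsConst θ ∧ g ∈ Hinf ∧ f = mulInf θ g

end PairedKernel

end

/-!
An element of `ker⁺_{a,b}` is an `f ∈ H²₊` with a partner `g ∈ H²₋` such that `a f + b g = 0`
(`mem_projKerPlus`). Multiplication by `h` with `star h ∈ H^∞` preserves `H²₋`, so it moves partners
to partners; this gives the two inclusions.

If `star h` is outer, equality amounts to dividing a partner by `h`: an `L²` function `φ` with
`h φ ∈ H²₋` lies in `H²₋` (`mem_H2_orthogonal_of_outer`). For this one finds `p ∈ H^∞` such that
`p * star h` has modulus at most one and is close in `L²` to a unimodular constant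
(`IsOuter.exists_mul_tendsto`). The multiplier `p` has modulus `1 / max (|h|, δ)`, and the mean
square distance to the constant is controlled by the value at the origin alone, which the
definition of outer functions makes a geometric mean. Such multipliers come from
`exists_mem_Hinf_norm_eq_exp`: for bounded real `ψ` the exponential of the analytic completion
`2 P⁺ ψ - ψ̂(0)` is in `H^∞`, by approximating `ψ` by uniformly bounded trigonometric polynomials,
for which the exponential series is available. The same multipliers give Jensen's inequality,
hence that outer functions are nonzero almost everywhere.

If `star h = θ g` with `θ` a nonconstant inner function and one of the inclusions is an equality,
then the common kernel is invariant under multiplication by `θ`. The partner `F` of any of its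
elements then satisfies `θ ^ n F ∈ H²₋` for all `n`, which forces `F = 0` because `|θ(0)| < 1`
(`eq_zero_of_inner_mul_mem`, `projKerPlus_eq_bot_of_inner`).
-/

noncomputable section

namespace PairedKernel

/-! ### Fourier coefficients of products -/

theorem memLp_top_fourier (n : ℤ) :
    MemLp (fun t : UnitAddCircle => fourier n t) ∞ circleMeasure := by
  refine memLp_top_of_bound (ContinuousMap.continuous _).aestronglyMeasurable 1 ?_
  exact .of_forall fun t => by rw [fourier_apply, Circle.norm_coe]

theorem fourierCoeff_star (f : UnitAddCircle → ℂ) (n : ℤ) :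
    fourierCoeff (fun t => star (f t)) n = star (fourierCoeff f (-n)) := by
  simp only [fourierCoeff, RCLike.star_def]
  rw [← integral_conj]
  refine integral_congr_ae (.of_forall fun t => ?_)
  simp only [smul_eq_mul, map_mul, neg_neg, fourier_neg]

/-- The coefficients of a product are the convolution of the coefficients: this is Parseval's
identity for the inner product of `conj u · z ^ n` with `f`. -/
theorem hasSum_fourierCoeff_mul {u f : UnitAddCircle → ℂ} (hu : MemLp u 2 circleMeasure)
    (hf : MemLp f 2 circleMeasure) (n : ℤ) :
    HasSum (fun k => fourierCoeff u (n - k) * fourierCoeff f k)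
      (fourierCoeff (fun t => u t * f t) n) := by
  have hw : MemLp (fun t => star (u t) * fourier n t) 2 circleMeasure :=
    (memLp_top_fourier n).mul' hu.star
  have key := (fourierBasis (T := 1)).hasSum_inner_mul_inner hw.toLp hf.toLp
  have e1 : inner ℂ hw.toLp hf.toLp = fourierCoeff (fun t => u t * f t) n := by
    rw [L2.inner_def, fourierCoeff]
    refine integral_congr_ae ?_
    filter_upwards [hw.coeFn_toLp, hf.coeFn_toLp] with t h1 h2
    rw [h1, h2, fourier_neg]
    simp
    ring
  have e2 (k : ℤ) : inner ℂ (fourierBasis (T := 1) k) hf.toLp = fourierCoeff f k := by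
    rw [← HilbertBasis.repr_apply_apply, fourierBasis_repr]
    exact congrFun (fourierCoeff_congr_ae hf.coeFn_toLp) k
  have e3 (k : ℤ) : inner ℂ hw.toLp (fourierBasis (T := 1) k) = fourierCoeff u (n - k) := by
    rw [← inner_conj_symm, ← HilbertBasis.repr_apply_apply, fourierBasis_repr,
      congrFun (fourierCoeff_congr_ae hw.coeFn_toLp) k, fourierCoeff, fourierCoeff, ← integral_conj]
    refine integral_congr_ae (.of_forall fun t => ?_)
    have : (fourier (-(n - k)) t : ℂ) = star (fourier n t) * fourier k t := by
      rw [neg_sub, sub_eq_neg_add, fourier_add, fourier_neg]; rfl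
    simp only [smul_eq_mul, this]
    simp [-fourier_apply, fourier_neg]
    ring
  simpa only [e1, e2, e3] using key

/-- The Fourier coefficients of negative index vanish. -/
def NonnegSpectrum (f : UnitAddCircle → ℂ) : Prop :=
  ∀ n : ℤ, n < 0 → fourierCoeff f n = 0

/-- The Fourier coefficients of nonnegative index vanish. -/
def NegSpectrum (f : UnitAddCircle → ℂ) : Prop :=
  ∀ n : ℤ, 0 ≤ n → fourierCoeff f n = 0

theorem NonnegSpectrum.congr {f g : UnitAddCircle → ℂ} (hf : NonnegSpectrum f)
    (h : f =ᵐ[circleMeasure] g) : NonnegSpectrum g := fun n hn => by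
  rw [← fourierCoeff_congr_ae h]; exact hf n hn

theorem NegSpectrum.congr {f g : UnitAddCircle → ℂ} (hf : NegSpectrum f)
    (h : f =ᵐ[circleMeasure] g) : NegSpectrum g := fun n hn => by
  rw [← fourierCoeff_congr_ae h]; exact hf n hn

theorem NonnegSpectrum.mul {u f : UnitAddCircle → ℂ} (hu : MemLp u 2 circleMeasure)
    (hf : MemLp f 2 circleMeasure) (hu' : NonnegSpectrum u) (hf' : NonnegSpectrum f) :
    NonnegSpectrum fun t => u t * f t := by
  intro n hn
  refine (hasSum_fourierCoeff_mul hu hf n).unique ?_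
  convert hasSum_zero with k
  rcases lt_or_ge k 0 with hk | hk
  · rw [hf' k hk, mul_zero]
  · rw [hu' _ (by omega), zero_mul]

theorem fourierCoeff_zero_mul {u f : UnitAddCircle → ℂ} (hu : MemLp u 2 circleMeasure)
    (hf : MemLp f 2 circleMeasure) (hu' : NonnegSpectrum u) (hf' : NonnegSpectrum f) :
    fourierCoeff (fun t => u t * f t) 0 = fourierCoeff u 0 * fourierCoeff f 0 := by
  refine (hasSum_fourierCoeff_mul hu hf 0).unique ?_
  refine hasSum_single (f := fun k => fourierCoeff u (0 - k) * fourierCoeff f k) 0 fun k hk => ?_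
  rcases lt_or_ge k 0 with hk' | hk'
  · rw [hf' k hk', mul_zero]
  · rw [hu' _ (by omega), zero_mul]

theorem NegSpectrum.star_mul {u f : UnitAddCircle → ℂ} (hu : MemLp u 2 circleMeasure)
    (hf : MemLp f 2 circleMeasure) (hu' : NonnegSpectrum u) (hf' : NegSpectrum f) :
    NegSpectrum fun t => star (u t) * f t := by
  intro n hn
  refine (hasSum_fourierCoeff_mul hu.star hf n).unique ?_
  convert hasSum_zero with k
  rcases lt_or_ge k 0 with hk | hk
  · change fourierCoeff (fun t => star (u t)) _ * _ = 0
    rw [fourierCoeff_star, hu' _ (by omega), star_zero, zero_mul]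
  · rw [hf' k hk, mul_zero]

/-! ### Paired kernels in terms of Fourier coefficients -/

theorem memLp_two (u : Linf) : MemLp u 2 circleMeasure :=
  (Lp.memLp u).mono_exponent le_top

theorem coeFn_mulOp (a : Linf) (f : L2) :
    mulOp a f =ᵐ[circleMeasure] fun t => a t * f t := by
  filter_upwards [(ContinuousLinearMap.mul ℂ ℂ).coeFn_holder (r := 2) a f] with t ht
  simpa [mulOp] using ht

theorem coeFn_mulInf (a b : Linf) :
    mulInf a b =ᵐ[circleMeasure] fun t => a t * b t := by
  filter_upwards [(ContinuousLinearMap.mul ℂ ℂ).coeFn_holder (r := ∞) a b] with t ht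
  simpa [mulInf] using ht

theorem mem_H2_iff {f : L2} : f ∈ H2 ↔ NonnegSpectrum f := Iff.rfl

theorem mem_H2_orthogonal_iff {g : L2} : g ∈ H2ᗮ ↔ NegSpectrum g := by
  constructor
  · intro hg n hn
    rw [fourierCoeff_eq_repr, HilbertBasis.repr_apply_apply]
    refine hg _ fun k hk => ?_
    rw [fourierCoeff_eq_repr, HilbertBasis.repr_self, lp.single_apply_ne]
    omega
  · intro hg f hf
    refine ((fourierBasis (T := 1)).hasSum_inner_mul_inner f g).unique ?_
    convert hasSum_zero with k
    rw [← inner_conj_symm, ← HilbertBasis.repr_apply_apply, ← HilbertBasis.repr_apply_apply,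
      fourierBasis_repr, fourierBasis_repr]
    rcases lt_or_ge k 0 with hk | hk
    · rw [hf k hk]; simp
    · rw [hg k hk]; simp

theorem eq_zero_of_fourierCoeff {f : L2} (hf : ∀ n, fourierCoeff f n = 0) : f = 0 := by
  apply (fourierBasis (T := 1)).repr.injective
  ext n
  rw [← fourierCoeff_eq_repr, hf]
  simp

theorem mulOp_mem_H2 {u : Linf} (hu : u ∈ Hinf) {f : L2} (hf : f ∈ H2) : mulOp u f ∈ H2 :=
  NonnegSpectrum.congr (NonnegSpectrum.mul (memLp_two u) (Lp.memLp f) hu hf) (coeFn_mulOp u f).symm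

theorem mulOp_mem_H2_orthogonal {h : Linf} (hh : star h ∈ Hinf) {g : L2} (hg : g ∈ H2ᗮ) :
    mulOp h g ∈ H2ᗮ := by
  rw [mem_H2_orthogonal_iff] at hg ⊢
  refine (NegSpectrum.star_mul (memLp_two (star h)) (Lp.memLp g) hh hg).congr ?_
  filter_upwards [coeFn_mulOp h g, Lp.coeFn_star h] with t h1 h2
  rw [h1, h2]
  simp

/-- An element of `ker⁺_{a,b}` is an `f ∈ H²₊` together with a partner `g ∈ H²₋` for which
`a f + b g = 0`. -/
theorem mem_projKerPlus {a b : Linf} {f : L2} :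
    f ∈ projKerPlus a b ↔ f ∈ H2 ∧ ∃ g ∈ H2ᗮ, ∀ᵐ t ∂circleMeasure, a t * f t + b t * g t = 0 := by
  have ae_iff (f g : L2) : mulOp a f + mulOp b g = 0 ↔
      ∀ᵐ t ∂circleMeasure, a t * f t + b t * g t = 0 := by
    rw [Lp.ext_iff]
    refine Filter.eventually_congr ?_
    filter_upwards [coeFn_mulOp a f, coeFn_mulOp b g, Lp.coeFn_add (mulOp a f) (mulOp b g),
      Lp.coeFn_zero ℂ 2 circleMeasure] with t h1 h2 h3 h4
    rw [h3, h4, Pi.add_apply, h1, h2, Pi.zero_apply]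
  constructor
  · rintro ⟨x, hx, rfl⟩
    refine ⟨H2.starProjection_apply_mem x, _, H2ᗮ.starProjection_apply_mem x, ?_⟩
    exact (ae_iff _ _).1 hx
  · rintro ⟨hf, g, hg, h⟩
    have hp : projPlus (f + g) = f := by
      rw [map_add, projPlus, Submodule.starProjection_eq_self_iff.2 hf,
        (Submodule.starProjection_apply_eq_zero_iff H2).2 hg, add_zero]
    have hm : projMinus (f + g) = g := by
      rw [map_add, projMinus, Submodule.starProjection_eq_self_iff.2 hg,
        (Submodule.starProjection_apply_eq_zero_iff H2ᗮ).2 (H2.le_orthogonal_orthogonal hf),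
        zero_add]
    refine ⟨f + g, ?_, hp⟩
    change mulOp a (projPlus (f + g)) + mulOp b (projMinus (f + g)) = 0
    rw [hp, hm]
    exact (ae_iff _ _).2 h

theorem projKerPlus_mulInf_right_le (a b : Linf) {h : Linf} (hh : star h ∈ Hinf) :
    projKerPlus a (mulInf b h) ≤ projKerPlus a b := by
  intro f hf
  obtain ⟨hf, g, hg, e⟩ := mem_projKerPlus.1 hf
  refine mem_projKerPlus.2 ⟨hf, mulOp h g, mulOp_mem_H2_orthogonal hh hg, ?_⟩
  filter_upwards [e, coeFn_mulInf b h, coeFn_mulOp h g] with t h1 h2 h3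
  rw [h3, ← h1, h2]; ring

theorem projKerPlus_le_mulInf_left (a b : Linf) {h : Linf} (hh : star h ∈ Hinf) :
    projKerPlus a b ≤ projKerPlus (mulInf a h) b := by
  intro f hf
  obtain ⟨hf, g, hg, e⟩ := mem_projKerPlus.1 hf
  refine mem_projKerPlus.2 ⟨hf, mulOp h g, mulOp_mem_H2_orthogonal hh hg, ?_⟩
  filter_upwards [e, coeFn_mulInf a h, coeFn_mulOp h g] with t h1 h2 h3
  rw [h3, h2]
  linear_combination h t * h1

/-! ### Inner functions and strictness of the inclusions -/

/-- Expanding the square shows that a function bounded by one is close to the constant `c` in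
mean square as soon as its mean is close to `c` and `‖c‖ = 1`. -/
theorem integral_norm_sub_sq_le {v : UnitAddCircle → ℂ}
    (hv : AEStronglyMeasurable v circleMeasure)
    (hv1 : ∀ᵐ t ∂circleMeasure, ‖v t‖ ≤ 1) (c : ℂ) :
    ∫ t, ‖v t - c‖ ^ 2 ∂circleMeasure ≤ 1 + ‖c‖ ^ 2 - 2 * (star c * fourierCoeff v 0).re := by
  have hi : Integrable v circleMeasure :=
    (memLp_top_of_bound hv 1 hv1).integrable le_top
  have hre : Integrable (fun t => 2 * (star c * v t).re) circleMeasure :=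
    ((hi.const_mul (star c)).re).const_mul 2
  have e : ∫ t, (1 + ‖c‖ ^ 2 - 2 * (star c * v t).re) ∂circleMeasure =
      1 + ‖c‖ ^ 2 - 2 * (star c * fourierCoeff v 0).re := by
    rw [integral_sub (integrable_const _) hre, integral_const_mul]
    have : ∫ t, (star c * v t).re ∂circleMeasure = (∫ t, star c * v t ∂circleMeasure).re :=
      integral_re (hi.const_mul (star c))
    rw [this, integral_const_mul]
    simp [fourierCoeff]
  rw [← e]
  refine integral_mono_of_nonneg (.of_forall fun t => by positivity)
    ((integrable_const _).sub hre) ?_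
  filter_upwards [hv1] with t ht
  have h1 : ‖v t - c‖ ^ 2 = ‖v t‖ ^ 2 + ‖c‖ ^ 2 - 2 * (star c * v t).re := by
    simp only [Complex.sq_norm, Complex.normSq_apply]
    simp
    ring
  have h2 : ‖v t‖ ^ 2 ≤ 1 := pow_le_one₀ (norm_nonneg _) ht
  linarith

theorem IsInner.norm_fourierCoeff_zero_lt_one {θ : Linf} (hθ : IsInner θ) (hc : ¬ IsConst θ) :
    ‖fourierCoeff θ 0‖ < 1 := by
  by_contra! hge
  set c := fourierCoeff θ 0 with hcdef
  refine hc ⟨c, ?_⟩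
  have hle := integral_norm_sub_sq_le (Lp.aestronglyMeasurable θ) (hθ.2.mono fun t ht => ht.le) c
  have h1 : (star c * c).re = ‖c‖ ^ 2 := by
    simp only [Complex.sq_norm, Complex.normSq_apply]
    simp
  rw [← hcdef, h1] at hle
  have h0 : ∫ t, ‖θ t - c‖ ^ 2 ∂circleMeasure = 0 :=
    le_antisymm (by nlinarith) (integral_nonneg fun t => by positivity)
  have hm : MemLp (fun t => θ t - c) 2 circleMeasure := (memLp_two θ).sub (memLp_const c)
  rw [integral_eq_zero_iff_of_nonneg (fun t => by positivity) hm.norm.integrable_sq] at h0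
  filter_upwards [h0] with t ht
  simpa [sub_eq_zero] using ht

theorem norm_fourierCoeff_le (f : L2) (n : ℤ) : ‖fourierCoeff f n‖ ≤ ‖f‖ := by
  rw [fourierCoeff_eq_repr, HilbertBasis.repr_apply_apply]
  refine (norm_inner_le_norm _ _).trans_eq ?_
  rw [(fourierBasis (T := 1)).orthonormal.1 n, one_mul]

/-- No nonzero function in `H²₋` remains in `H²₋` under multiplication by all powers of a
nonconstant inner function `θ`: its leading coefficient is the product of the `n`-th power of the
conjugate of `θ(0)` with a bounded quantity, for every `n`. -/
theorem eq_zero_of_inner_mul_mem {θ : Linf} (hθ : IsInner θ) (hc : ¬ IsConst θ) {F : ℕ → L2}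
    (hF : ∀ n, F n ∈ H2ᗮ) (hs : ∀ n, F (n + 1) =ᵐ[circleMeasure] fun t => θ t * F n t) :
    F 0 = 0 := by
  have hnorm (n : ℕ) : ‖F n‖ ≤ ‖F 0‖ := by
    induction n with
    | zero => rfl
    | succ n ih =>
      refine le_trans (Lp.norm_le_norm_of_ae_le ?_) ih
      filter_upwards [hs n, hθ.2] with t h1 h2
      rw [h1, norm_mul, h2, one_mul]
  have hback (n : ℕ) : F n =ᵐ[circleMeasure] fun t => star (θ t) * F (n + 1) t := by
    filter_upwards [hs n, hθ.2] with t h1 h2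
    have : star (θ t) * θ t = 1 := by
      rw [RCLike.star_def, ← Complex.normSq_eq_conj_mul_self, Complex.normSq_eq_norm_sq, h2]
      simp
    rw [h1, ← mul_assoc, this, one_mul]
  have key (m : ℕ) : ∀ n, ∀ k : ℤ, -m ≤ k → fourierCoeff (F n) k = 0 := by
    induction m with
    | zero =>
      intro n k hk
      exact mem_H2_orthogonal_iff.1 (hF n) k (by simpa using hk)
    | succ m ih =>
      have step (n : ℕ) : fourierCoeff (F n) (-(m + 1 : ℤ)) =
          star (fourierCoeff θ 0) * fourierCoeff (F (n + 1)) (-(m + 1 : ℤ)) := by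
        rw [fourierCoeff_congr_ae (hback n)]
        refine (hasSum_fourierCoeff_mul (memLp_two θ).star (Lp.memLp (F (n + 1))) _).unique ?_
        have hst (j : ℤ) : fourierCoeff (star (θ : UnitAddCircle → ℂ)) j =
          star (fourierCoeff θ (-j)) := fourierCoeff_star _ j
        simp only [hst]
        convert hasSum_single (-(m + 1 : ℤ)) fun k hk => ?_ using 1
        · simp
        rcases lt_or_ge k (-(m + 1 : ℤ)) with hk' | hk'
        · rw [hθ.1 _ (by omega), star_zero, zero_mul]
        · rw [ih (n + 1) k (by omega), mul_zero]
      have pow (n j : ℕ) : fourierCoeff (F n) (-(m + 1 : ℤ)) =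
          star (fourierCoeff θ 0) ^ j * fourierCoeff (F (n + j)) (-(m + 1 : ℤ)) := by
        induction j with
        | zero => simp
        | succ j ihj => rw [ihj, step (n + j), pow_succ, mul_assoc, add_assoc]
      have hzero (n : ℕ) : fourierCoeff (F n) (-(m + 1 : ℤ)) = 0 := by
        have ht : Filter.Tendsto (fun j : ℕ => ‖fourierCoeff θ 0‖ ^ j * ‖F 0‖) Filter.atTop
            (nhds (0 * ‖F 0‖)) :=
          (tendsto_pow_atTop_nhds_zero_of_lt_one (norm_nonneg _)
            (hθ.norm_fourierCoeff_zero_lt_one hc)).mul_const _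
        rw [zero_mul] at ht
        refine norm_le_zero_iff.1 (ge_of_tendsto' ht fun j => ?_)
        rw [pow n j, norm_mul, norm_pow, norm_star]
        gcongr
        exact (norm_fourierCoeff_le _ _).trans (hnorm _)
      intro n k hk
      rcases eq_or_lt_of_le hk with h | h
      · rw [← h]
        simpa using hzero n
      · exact ih n k (by push_cast at h; omega)
  refine eq_zero_of_fourierCoeff fun k => key k.natAbs 0 k ?_
  omega

/-- A projected paired kernel invariant under a nonconstant inner function is trivial. -/
theorem projKerPlus_eq_bot_of_inner {a b θ : Linf} (ha : ∀ᵐ t ∂circleMeasure, a t ≠ 0)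
    (hb : ∀ᵐ t ∂circleMeasure, b t ≠ 0) (hθ : IsInner θ) (hc : ¬ IsConst θ)
    (hinv : ∀ f ∈ projKerPlus a b, mulOp θ f ∈ projKerPlus a b) : projKerPlus a b = ⊥ := by
  rw [eq_bot_iff]
  intro f hf
  have hmem (n : ℕ) : (mulOp θ)^[n] f ∈ projKerPlus a b := by
    induction n with
    | zero => exact hf
    | succ n ih => rw [Function.iterate_succ_apply']; exact hinv _ ih
  choose G hG hGe using fun n => (mem_projKerPlus.1 (hmem n)).2
  have hG0 : G 0 = 0 := by
    refine eq_zero_of_inner_mul_mem hθ hc hG fun n => ?_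
    have e1 := hGe (n + 1)
    rw [Function.iterate_succ_apply'] at e1
    filter_upwards [e1, hGe n, hb, coeFn_mulOp θ ((mulOp θ)^[n] f)] with t h1 h2 h3 h4
    rw [h4] at h1
    refine mul_left_cancel₀ h3 ?_
    linear_combination h1 - θ t * h2
  rw [Submodule.mem_bot, Lp.eq_zero_iff_ae_eq_zero]
  have hG0' : G 0 =ᵐ[circleMeasure] 0 := (Lp.eq_zero_iff_ae_eq_zero).1 hG0
  filter_upwards [hGe 0, hG0', ha] with t h1 h2 h3
  rw [h2] at h1
  simpa [h3] using h1

/-- If `star h = θ g` with `θ` inner, then multiplying `h` by `θ` cancels its inner factor. -/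
theorem inner_mul_ae_eq_star {h θ g : Linf} (hθ : IsInner θ) (e : star h = mulInf θ g) :
    ∀ᵐ t ∂circleMeasure, θ t * h t = (star g : Linf) t := by
  have e' : (star h : Linf) =ᵐ[circleMeasure] mulInf θ g := by rw [e]
  filter_upwards [e', coeFn_mulInf θ g, Lp.coeFn_star h, Lp.coeFn_star g, hθ.2]
    with t h1 h2 h3 h4 h5
  rw [h2, h3, Pi.star_apply] at h1
  have hh : h t = star (θ t * g t) := by rw [← h1, star_star]
  have hθθ : θ t * star (θ t) = 1 := by
    rw [RCLike.star_def, Complex.mul_conj, Complex.normSq_eq_norm_sq, h5]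
    simp
  rw [h4, Pi.star_apply, hh, star_mul]
  linear_combination star (g t) * hθθ

/-- Were the kernels equal, they would be invariant under `θ`: a solution of `a f + b h k = 0` gives
`a (θ f) + b (star g k) = 0`. -/
theorem projKerPlus_mulInf_right_ne {a b h : Linf} (ha : ∀ᵐ t ∂circleMeasure, a t ≠ 0)
    (hb : ∀ᵐ t ∂circleMeasure, b t ≠ 0) (hI : HasNonconstInnerFactor (star h))
    (hne : projKerPlus a b ≠ ⊥) : projKerPlus a (mulInf b h) ≠ projKerPlus a b := by
  obtain ⟨θ, g, hθ, hc, hg, e⟩ := hI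
  intro heq
  refine hne (projKerPlus_eq_bot_of_inner ha hb hθ hc fun f hf => ?_)
  obtain ⟨hf, k, hk, ek⟩ := mem_projKerPlus.1 (heq.symm ▸ hf)
  refine mem_projKerPlus.2 ⟨mulOp_mem_H2 hθ.1 hf, mulOp (star g) k,
    mulOp_mem_H2_orthogonal (by rwa [star_star]) hk, ?_⟩
  filter_upwards [ek, coeFn_mulOp θ f, coeFn_mulOp (star g) k, coeFn_mulInf b h,
    inner_mul_ae_eq_star hθ e] with t h1 h2 h3 h4 h5
  rw [h4] at h1
  rw [h2, h3, ← h5]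
  linear_combination θ t * h1

theorem ne_projKerPlus_mulInf_left {a b h : Linf} (ha : ∀ᵐ t ∂circleMeasure, a t ≠ 0)
    (hb : ∀ᵐ t ∂circleMeasure, b t ≠ 0) (hI : HasNonconstInnerFactor (star h))
    (hne : projKerPlus (mulInf a h) b ≠ ⊥) : projKerPlus a b ≠ projKerPlus (mulInf a h) b := by
  obtain ⟨θ, g, hθ, hc, hg, e⟩ := hI
  intro heq
  rw [← heq] at hne
  refine hne (projKerPlus_eq_bot_of_inner ha hb hθ hc fun f hf => ?_)
  obtain ⟨hf, k, hk, ek⟩ := mem_projKerPlus.1 hf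
  rw [heq]
  refine mem_projKerPlus.2 ⟨mulOp_mem_H2 hθ.1 hf, mulOp (star g) k,
    mulOp_mem_H2_orthogonal (by rwa [star_star]) hk, ?_⟩
  filter_upwards [ek, coeFn_mulOp θ f, coeFn_mulOp (star g) k, coeFn_mulInf a h,
    inner_mul_ae_eq_star hθ e] with t h1 h2 h3 h4 h5
  rw [h2, h3, h4, ← h5]
  linear_combination θ t * h t * h1

/-! ### Exponentials of bounded analytic functions -/

theorem tendsto_fourierCoeff_of_dominated {F : ℕ → UnitAddCircle → ℂ} {f : UnitAddCircle → ℂ}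
    {C : ℝ} (hm : ∀ k, AEStronglyMeasurable (F k) circleMeasure)
    (hb : ∀ k, ∀ᵐ t ∂circleMeasure, ‖F k t‖ ≤ C)
    (hl : ∀ᵐ t ∂circleMeasure, Filter.Tendsto (fun k => F k t) Filter.atTop (nhds (f t))) (n : ℤ) :
    Filter.Tendsto (fun k => fourierCoeff (F k) n) Filter.atTop (nhds (fourierCoeff f n)) := by
  refine tendsto_integral_of_dominated_convergence (fun _ => C)
    (fun k => (memLp_top_fourier _).1.mul (hm k)) (integrable_const C) (fun k => ?_) ?_
  · filter_upwards [hb k] with t ht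
    rw [norm_smul, fourier_apply, Circle.norm_coe, one_mul]
    exact ht
  · filter_upwards [hl] with t ht
    exact ht.const_smul _

theorem nonnegSpectrum_one : NonnegSpectrum fun _ => 1 := by
  intro n hn
  have h : (fun _ => 1 : UnitAddCircle → ℂ) = fourier 0 := by ext t; simp
  rw [h, fourierCoeff_fourier, Pi.single_eq_of_ne hn.ne]

theorem memLp_top_pow {f : UnitAddCircle → ℂ} (hf : MemLp f ∞ circleMeasure) (k : ℕ) :
    MemLp (fun t => f t ^ k) ∞ circleMeasure := by
  induction k with
  | zero => simpa using memLp_const 1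
  | succ k ih =>
    simp only [pow_succ]
    exact hf.mul' ih

theorem NonnegSpectrum.pow {f : UnitAddCircle → ℂ} (hf : MemLp f ∞ circleMeasure)
    (hs : NonnegSpectrum f) (k : ℕ) :
    NonnegSpectrum (fun t => f t ^ k) ∧
      fourierCoeff (fun t => f t ^ k) 0 = fourierCoeff f 0 ^ k := by
  induction k with
  | zero =>
    simp only [pow_zero]
    exact ⟨nonnegSpectrum_one, by simp [fourierCoeff]⟩
  | succ k ih =>
    have h1 := (memLp_top_pow hf k).mono_exponent (p := 2) le_top
    have h2 := hf.mono_exponent (p := 2) le_top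
    simp only [pow_succ]
    exact ⟨ih.1.mul h1 h2 hs, by rw [fourierCoeff_zero_mul h1 h2 ih.1 hs, ih.2]⟩

theorem ae_norm_le_of_memLp_top {f : UnitAddCircle → ℂ} (hf : MemLp f ∞ circleMeasure) :
    ∀ᵐ t ∂circleMeasure, ‖f t‖ ≤ (eLpNorm f ∞ circleMeasure).toReal := by
  rw [eLpNorm_exponent_top]
  filter_upwards [ae_le_eLpNormEssSup (f := f) (μ := circleMeasure)] with t ht
  have hfin : eLpNormEssSup f circleMeasure ≠ ∞ := by
    rw [← eLpNorm_exponent_top]; exact hf.2.ne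
  simpa using ENNReal.toReal_mono hfin ht

theorem hasSum_fourierCoeff_exp {f : UnitAddCircle → ℂ} (hf : MemLp f ∞ circleMeasure) (n : ℤ) :
    HasSum (fun k : ℕ => fourierCoeff (fun t => f t ^ k) n / (k.factorial : ℂ))
      (fourierCoeff (fun t => Complex.exp (f t)) n) := by
  have hC := ae_norm_le_of_memLp_top hf
  set C := (eLpNorm f ∞ circleMeasure).toReal
  have key := hasSum_integral_of_dominated_convergence (μ := circleMeasure)
    (F := fun (k : ℕ) t => fourier (-n) t * (f t ^ k / (k.factorial : ℂ)))
    (f := fun t => fourier (-n) t * Complex.exp (f t))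
    (fun k _ => C ^ k / k.factorial) (fun k => ?_) (fun k => ?_) ?_ ?_ ?_
  · simp only [fourierCoeff, smul_eq_mul]
    simpa only [← mul_div_assoc, integral_div] using key
  · exact (memLp_top_fourier _).1.mul (by
      simpa only [div_eq_mul_inv] using (memLp_top_pow hf k).1.mul_const _)
  · filter_upwards [hC] with t ht
    rw [norm_mul, fourier_apply, Circle.norm_coe, one_mul, norm_div, norm_pow, Complex.norm_natCast]
    gcongr
  · exact .of_forall fun _ => Real.summable_pow_div_factorial C
  · exact integrable_const _
  · refine .of_forall fun t => HasSum.mul_left _ ?_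
    rw [Complex.exp_eq_exp_ℂ]
    exact NormedSpace.expSeries_div_hasSum_exp (f t)

theorem NonnegSpectrum.exp {f : UnitAddCircle → ℂ} (hf : MemLp f ∞ circleMeasure)
    (hs : NonnegSpectrum f) : NonnegSpectrum fun t => Complex.exp (f t) := fun n hn => by
  refine (hasSum_fourierCoeff_exp hf n).unique ?_
  convert hasSum_zero with k
  rw [(hs.pow hf k).1 n hn, zero_div]

theorem fourierCoeff_zero_exp {f : UnitAddCircle → ℂ} (hf : MemLp f ∞ circleMeasure)
    (hs : NonnegSpectrum f) :
    fourierCoeff (fun t => Complex.exp (f t)) 0 = Complex.exp (fourierCoeff f 0) := by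
  refine (hasSum_fourierCoeff_exp hf 0).unique ?_
  simp only [(hs.pow hf _).2]
  rw [Complex.exp_eq_exp_ℂ]
  exact NormedSpace.expSeries_div_hasSum_exp _

/-! ### Analytic completion and outer functions with bounded modulus -/

/-- The analytic completion `2 P⁺ ψ - ψ̂(0)` of `ψ ∈ L²`: for real `ψ` it is the element of `H²₊`
with real part `ψ` whose coefficient of index zero is that of `ψ`. -/
def analyticCompletion : L2 →L[ℂ] L2 :=
  (2 : ℂ) • projPlus - (innerSL ℂ (fourierBasis (T := 1) 0)).smulRight (fourierBasis (T := 1) 0)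

theorem fourierCoeff_projPlus (f : L2) (n : ℤ) :
    fourierCoeff (projPlus f) n = if 0 ≤ n then fourierCoeff f n else 0 := by
  split_ifs with hn
  · have h := mem_H2_orthogonal_iff.1 (H2.sub_starProjection_mem_orthogonal f) n hn
    rw [fourierCoeff_eq_repr, map_sub, lp.coeFn_sub, Pi.sub_apply, sub_eq_zero,
      ← fourierCoeff_eq_repr, ← fourierCoeff_eq_repr] at h
    exact h.symm
  · exact mem_H2_iff.1 (H2.starProjection_apply_mem f) n (not_le.1 hn)

theorem fourierCoeff_fourierBasis (k n : ℤ) :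
    fourierCoeff (fourierBasis (T := 1) k) n = if n = k then 1 else 0 := by
  rw [fourierCoeff_eq_repr, HilbertBasis.repr_self, lp.single_apply, Pi.single_apply]

theorem fourierCoeff_analyticCompletion (f : L2) (n : ℤ) :
    fourierCoeff (analyticCompletion f) n =
      if n = 0 then fourierCoeff f 0 else if 0 < n then 2 * fourierCoeff f n else 0 := by
  have e : fourierCoeff (analyticCompletion f) n =
      2 * fourierCoeff (projPlus f) n -
        fourierCoeff f 0 * fourierCoeff (fourierBasis (T := 1) 0) n := by
    simp only [fourierCoeff_eq_repr, HilbertBasis.repr_apply_apply, analyticCompletion]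
    simp [inner_sub_right, inner_smul_right]
  rw [e, fourierCoeff_projPlus, fourierCoeff_fourierBasis]
  rcases lt_trichotomy n 0 with h | h | h
  · simp [h.ne, h.not_ge, h.not_gt]
  · subst h; simp; ring
  · simp [h.ne', h.le, h]

theorem nonnegSpectrum_analyticCompletion (f : L2) : NonnegSpectrum (analyticCompletion f) :=
  fun n hn => by rw [fourierCoeff_analyticCompletion, if_neg hn.ne, if_neg hn.not_gt]

theorem re_analyticCompletion {f : L2} (hf : ∀ᵐ t ∂circleMeasure, star (f t) = f t) :
    ∀ᵐ t ∂circleMeasure, ((analyticCompletion f t).re : ℂ) = f t := by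
  set G := analyticCompletion f
  have hc (n : ℤ) : fourierCoeff f n = star (fourierCoeff f (-n)) := by
    rw [← fourierCoeff_star, fourierCoeff_congr_ae hf]
  have hG (n : ℤ) : fourierCoeff (star G : L2) n = star (fourierCoeff G (-n)) := by
    rw [← fourierCoeff_star, fourierCoeff_congr_ae (Lp.coeFn_star G)]
    rfl
  have h0 : G + star G - (2 : ℂ) • f = 0 := by
    refine eq_zero_of_fourierCoeff fun n => ?_
    have e : fourierCoeff (G + star G - (2 : ℂ) • f : L2) n =
        fourierCoeff G n + fourierCoeff (star G : L2) n - 2 * fourierCoeff f n := by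
      simp only [fourierCoeff_eq_repr, map_sub, map_add, map_smul]
      rfl
    rw [e, hG, fourierCoeff_analyticCompletion, fourierCoeff_analyticCompletion]
    rcases lt_trichotomy n 0 with h | h | h
    · rw [if_neg h.ne, if_neg h.not_gt, if_neg (by omega), if_pos (by omega), star_mul', ← hc n]
      simp
    · subst h
      have := hc 0
      rw [neg_zero] at this
      simp [← this]
      ring
    · rw [if_neg h.ne', if_pos h, if_neg (by omega), if_neg (by omega)]
      simp
  filter_upwards [(Lp.eq_zero_iff_ae_eq_zero).1 h0, Lp.coeFn_sub (G + star G) ((2 : ℂ) • f),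
    Lp.coeFn_add G (star G), Lp.coeFn_smul (2 : ℂ) f, Lp.coeFn_star G] with t h1 h2 h3 h4 h5
  rw [h2, Pi.sub_apply, h3, Pi.add_apply, h4, h5] at h1
  simp only [Pi.smul_apply, Pi.star_apply, smul_eq_mul, Pi.zero_apply, RCLike.star_def,
    Complex.add_conj] at h1
  push_cast at h1
  linear_combination h1 / 2

/-- The analytic completion of a trigonometric polynomial is again one, hence bounded; that of a
general bounded function need not be. -/
theorem memLp_top_analyticCompletion {q : C(UnitAddCircle, ℂ)}
    (hq : q ∈ fourierSubalgebra (T := 1)) :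
    MemLp (analyticCompletion (ContinuousMap.toLp 2 circleMeasure ℂ q)) ∞ circleMeasure := by
  have hB : ∀ (f g : L2) (c : ℂ), MemLp f ∞ circleMeasure → MemLp g ∞ circleMeasure →
      MemLp (f + c • g : L2) ∞ circleMeasure := fun f g c hf hg =>
    (memLp_congr_ae (by
      filter_upwards [Lp.coeFn_add f (c • g), Lp.coeFn_smul c g] with t h1 h2
      rw [h1, Pi.add_apply, Pi.add_apply, h2])).2 (hf.add (hg.const_smul c))
  have hbasis (n : ℤ) : MemLp (fourierBasis (T := 1) n) ∞ circleMeasure := by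
    rw [coe_fourierBasis]
    exact (memLp_congr_ae (coeFn_fourierLp 2 n)).2 (memLp_top_fourier n)
  have h0 : MemLp (0 : L2) ∞ circleMeasure :=
    (memLp_congr_ae (Lp.coeFn_zero ℂ 2 circleMeasure)).2 MemLp.zero
  have hmono (n : ℤ) : MemLp (analyticCompletion (fourierBasis (T := 1) n)) ∞ circleMeasure := by
    obtain ⟨c, hc⟩ : ∃ c : ℂ, analyticCompletion (fourierBasis (T := 1) n) =
        0 + c • fourierBasis (T := 1) n := by
      refine ⟨if n = 0 then 1 else if 0 < n then 2 else 0, ?_⟩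
      rw [zero_add, ← sub_eq_zero]
      refine eq_zero_of_fourierCoeff fun k => ?_
      rw [fourierCoeff_eq_repr, map_sub, map_smul, lp.coeFn_sub, lp.coeFn_smul, Pi.sub_apply,
        Pi.smul_apply, ← fourierCoeff_eq_repr, ← fourierCoeff_eq_repr,
        fourierCoeff_analyticCompletion]
      simp only [fourierCoeff_fourierBasis]
      rcases eq_or_ne k n with rfl | h
      · rcases eq_or_ne k 0 with rfl | h' <;> simp [*]
      · rcases eq_or_ne k 0 with rfl | h' <;> simp [*]
    rw [hc]
    exact hB _ _ _ h0 (hbasis n)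
  have hspan : q ∈ Submodule.span ℂ (Set.range (fourier (T := 1))) := by
    rw [← fourierSubalgebra_coe]; exact hq
  induction hspan using Submodule.span_induction with
  | mem x hx =>
    obtain ⟨n, rfl⟩ := hx
    have := hmono n
    rwa [coe_fourierBasis] at this
  | zero => simpa using h0
  | add x y hx hy h1 h2 =>
    have hx' : x ∈ fourierSubalgebra (T := 1) := by
      change x ∈ Subalgebra.toSubmodule (fourierSubalgebra (T := 1)).toSubalgebra
      rwa [fourierSubalgebra_coe]
    have hy' : y ∈ fourierSubalgebra (T := 1) := by
      change y ∈ Subalgebra.toSubmodule (fourierSubalgebra (T := 1)).toSubalgebra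
      rwa [fourierSubalgebra_coe]
    have := hB _ _ 1 (h1 hx') (h2 hy')
    rw [one_smul] at this
    rwa [map_add, map_add]
  | smul c x hx h1 =>
    have hx' : x ∈ fourierSubalgebra (T := 1) := by
      change x ∈ Subalgebra.toSubmodule (fourierSubalgebra (T := 1)).toSubalgebra
      rwa [fourierSubalgebra_coe]
    have := hB _ _ c h0 (h1 hx')
    rw [zero_add] at this
    rwa [map_smul, map_smul]

/-- A bounded real function is approximated in `L²` by real trigonometric polynomials with a
uniform bound. -/
theorem exists_trigPoly_approx {ψ : UnitAddCircle → ℝ} {M : ℝ}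
    (hM : ∀ᵐ t ∂circleMeasure, |ψ t| ≤ M)
    (hψ : MemLp (fun t => (ψ t : ℂ)) 2 circleMeasure) {ε : ℝ} (hε : 0 < ε) :
    ∃ q ∈ fourierSubalgebra (T := 1), star q = q ∧ (∀ t, ‖q t‖ ≤ M + 1) ∧
      ‖ContinuousMap.toLp 2 circleMeasure ℂ q - hψ.toLp‖ ≤ ε := by
  have hψr : MemLp ψ 2 circleMeasure := by simpa using hψ.re
  have hM0 : 0 ≤ M := by
    obtain ⟨t, ht⟩ := hM.exists
    exact (abs_nonneg _).trans ht
  obtain ⟨g, hg, -⟩ := hψr.exists_boundedContinuous_eLpNorm_sub_le (by simp)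
    (ε := ENNReal.ofReal (ε / 2)) (by simpa using hε)
  -- Truncating the approximant to `[-M, M]` brings it closer to `ψ`.
  let g' : C(UnitAddCircle, ℂ) :=
    ⟨fun t => ((max (-M) (min M (g t)) : ℝ) : ℂ), by fun_prop⟩
  have hg' (t) : ‖g' t‖ ≤ M := by
    change ‖((max (-M) (min M (g t)) : ℝ) : ℂ)‖ ≤ M
    rw [Complex.norm_real, Real.norm_eq_abs, abs_le]
    exact ⟨le_max_left _ _, max_le (by linarith) (min_le_left _ _)⟩
  have hgψ : eLpNorm (fun t => g' t - ψ t) 2 circleMeasure ≤ ENNReal.ofReal (ε / 2) := by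
    refine (eLpNorm_mono_ae ?_).trans hg
    filter_upwards [hM] with t ht
    change ‖((max (-M) (min M (g t)) : ℝ) : ℂ) - ψ t‖ ≤ ‖ψ t - g t‖
    rw [← Complex.ofReal_sub, Complex.norm_real, norm_sub_rev, Real.norm_eq_abs, Real.norm_eq_abs]
    rw [abs_le] at ht
    rcases max_cases (-M) (min M (g t)) with h | h <;> rcases min_cases M (g t) with h' | h' <;>
      rcases abs_cases (ψ t - max (-M) (min M (g t))) with h'' | h'' <;>
      rcases abs_cases (ψ t - g t) with h3 | h3 <;> linarith
  have hdense : g' ∈ (fourierSubalgebra (T := 1)).topologicalClosure := by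
    rw [fourierSubalgebra_closure_eq_top]; trivial
  obtain ⟨p, hp, hpg⟩ := Metric.mem_closure_iff.1 hdense (min 1 (ε / 2)) (by positivity)
  have hg's : star g' = g' := by
    ext t
    exact Complex.conj_ofReal _
  let q : C(UnitAddCircle, ℂ) := (2⁻¹ : ℂ) • (p + star p)
  have hqg (t) : ‖q t - g' t‖ ≤ min 1 (ε / 2) := by
    have h1 : ‖g' t - p t‖ ≤ min 1 (ε / 2) := by
      rw [← dist_eq_norm]
      exact (ContinuousMap.dist_apply_le_dist t).trans hpg.le
    have h2 : ‖g' t - star (p t)‖ ≤ min 1 (ε / 2) := by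
      rw [← hg's, ContinuousMap.star_apply, ← star_sub, norm_star]
      exact h1
    have e : q t - g' t = -((2⁻¹ : ℂ) * ((g' t - p t) + (g' t - star (p t)))) := by
      change (2⁻¹ : ℂ) * (p t + star (p t)) - g' t = _
      ring
    rw [e, norm_neg, norm_mul]
    have := norm_add_le (g' t - p t) (g' t - star (p t))
    norm_num
    norm_num at h1 h2 this
    constructor <;> linarith
  refine ⟨q, ?_, ?_, fun t => ?_, ?_⟩
  · exact (fourierSubalgebra (T := 1)).smul_mem (add_mem hp (star_mem hp)) _
  · ext t
    simp [q, add_comm]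
  · have h1 := (hqg t).trans (min_le_left _ _)
    have h2 := norm_add_le (q t - g' t) (g' t)
    rw [sub_add_cancel] at h2
    linarith [hg' t]
  · have hq2 : MemLp (fun t => q t) 2 circleMeasure :=
      MemLp.of_bound q.continuous.aestronglyMeasurable ‖q‖ (.of_forall fun t => q.norm_coe_le_norm t)
    have e : ContinuousMap.toLp 2 circleMeasure ℂ q = hq2.toLp := by
      refine Lp.ext ?_
      filter_upwards [ContinuousMap.coeFn_toLp (p := 2) (𝕜 := ℂ) circleMeasure q, hq2.coeFn_toLp]
        with t h1 h2
      rw [h1, h2]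
    rw [e, ← MemLp.toLp_sub, Lp.norm_toLp]
    refine ENNReal.toReal_le_of_le_ofReal hε.le ?_
    have hsum : ((fun t => q t) - fun t => (ψ t : ℂ)) =
        (fun t => q t - g' t) + fun t => g' t - ψ t := by ext t; simp
    rw [hsum]
    have hm1 : AEStronglyMeasurable (fun t => q t - g' t) circleMeasure :=
      (q.continuous.sub g'.continuous).aestronglyMeasurable
    have hm2 : AEStronglyMeasurable (fun t => g' t - (ψ t : ℂ)) circleMeasure :=
      g'.continuous.aestronglyMeasurable.sub hψ.1
    refine (eLpNorm_add_le hm1 hm2 (by norm_num)).trans ?_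
    have hb : eLpNorm (fun t => q t - g' t) 2 circleMeasure ≤ ENNReal.ofReal (ε / 2) := by
      refine (eLpNorm_le_of_ae_bound (C := ε / 2)
        (.of_forall fun t => (hqg t).trans (min_le_right _ _))).trans ?_
      simp
    refine (add_le_add hb hgψ).trans ?_
    rw [← ENNReal.ofReal_add (by positivity) (by positivity), add_halves]

/-- For bounded real `ψ` there is a bounded analytic function of modulus `exp ψ` whose value at the
origin is the geometric mean of that modulus. -/
theorem exists_mem_Hinf_norm_eq_exp {ψ : UnitAddCircle → ℝ} {M : ℝ}
    (hm : AEStronglyMeasurable ψ circleMeasure) (hM : ∀ᵐ t ∂circleMeasure, |ψ t| ≤ M) :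
    ∃ p ∈ Hinf, (∀ᵐ t ∂circleMeasure, ‖p t‖ = Real.exp (ψ t)) ∧
      fourierCoeff p 0 = (Real.exp (∫ t, ψ t ∂circleMeasure) : ℂ) := by
  have hψ : MemLp (fun t => (ψ t : ℂ)) 2 circleMeasure :=
    MemLp.of_bound (Complex.continuous_ofReal.comp_aestronglyMeasurable hm) M
      (hM.mono fun t ht => by simpa using ht)
  choose q hqA hqs hqb hqn using fun k : ℕ =>
    exists_trigPoly_approx hM hψ (ε := 1 / ((k : ℝ) + 1)) (by positivity)
  let Q (k : ℕ) : L2 := ContinuousMap.toLp 2 circleMeasure ℂ (q k)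
  have hQ (k : ℕ) : Q k =ᵐ[circleMeasure] q k :=
    ContinuousMap.coeFn_toLp (p := 2) (𝕜 := ℂ) circleMeasure (q k)
  set Ψ : L2 := hψ.toLp with hΨ
  have hΨe : Ψ =ᵐ[circleMeasure] fun t => (ψ t : ℂ) := hψ.coeFn_toLp
  have hQΨ : Filter.Tendsto Q Filter.atTop (nhds Ψ) :=
    tendsto_iff_norm_sub_tendsto_zero.2
      (squeeze_zero (fun _ => norm_nonneg _) hqn tendsto_one_div_add_atTop_nhds_zero_nat)
  have hF : Filter.Tendsto (fun k => analyticCompletion (Q k)) Filter.atTop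
      (nhds (analyticCompletion Ψ)) := (analyticCompletion.continuous.tendsto Ψ).comp hQΨ
  obtain ⟨ns, hmono, hns⟩ := (tendstoInMeasure_of_tendsto_Lp hF).exists_seq_tendsto_ae
  have hreG : ∀ᵐ t ∂circleMeasure, (analyticCompletion Ψ t).re = ψ t := by
    have hs : ∀ᵐ t ∂circleMeasure, star (Ψ t) = Ψ t := by
      filter_upwards [hΨe] with t h1
      rw [h1]
      exact Complex.conj_ofReal _
    filter_upwards [re_analyticCompletion hs, hΨe] with t h1 h2
    rw [h2] at h1
    exact_mod_cast h1
  have hreF (k : ℕ) : ∀ᵐ t ∂circleMeasure, (analyticCompletion (Q k) t).re ≤ M + 1 := by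
    have hs : ∀ᵐ t ∂circleMeasure, star (Q k t) = Q k t := by
      filter_upwards [hQ k] with t h1
      rw [h1]
      exact congrArg (fun r : C(UnitAddCircle, ℂ) => r t) (hqs k)
    filter_upwards [re_analyticCompletion hs, hQ k] with t h1 h2
    refine le_trans ?_ (hqb k t)
    rw [← h2, ← h1, Complex.norm_real]
    exact le_abs_self _
  have hexpm (f : L2) : AEStronglyMeasurable (fun t => Complex.exp (f t)) circleMeasure :=
    Complex.continuous_exp.comp_aestronglyMeasurable (Lp.aestronglyMeasurable f)
  have hlim (n : ℤ) := tendsto_fourierCoeff_of_dominated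
    (F := fun k t => Complex.exp (analyticCompletion (Q (ns k)) t))
    (f := fun t => Complex.exp (analyticCompletion Ψ t)) (C := Real.exp (M + 1))
    (fun k => hexpm _)
    (fun k => by
      filter_upwards [hreF (ns k)] with t ht
      rw [Complex.norm_exp]
      exact Real.exp_le_exp.2 ht)
    (by
      filter_upwards [hns] with t ht
      exact (Complex.continuous_exp.tendsto _).comp ht) n
  have hnorm : ∀ᵐ t ∂circleMeasure, ‖Complex.exp (analyticCompletion Ψ t)‖ = Real.exp (ψ t) := by
    filter_upwards [hreG] with t ht
    rw [Complex.norm_exp, ht]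
  have hP : MemLp (fun t => Complex.exp (analyticCompletion Ψ t)) ∞ circleMeasure := by
    refine memLp_top_of_bound (hexpm _) (Real.exp M) ?_
    filter_upwards [hnorm, hM] with t h1 h2
    rw [h1]
    exact Real.exp_le_exp.2 ((le_abs_self _).trans h2)
  have hQtop (k : ℕ) : MemLp (analyticCompletion (Q k)) ∞ circleMeasure :=
    memLp_top_analyticCompletion (hqA k)
  refine ⟨hP.toLp, ?_, ?_, ?_⟩
  · refine NonnegSpectrum.congr (fun n hn => ?_) hP.coeFn_toLp.symm
    refine tendsto_nhds_unique (hlim n) ?_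
    simp only [((nonnegSpectrum_analyticCompletion (Q _)).exp (hQtop _)) n hn]
    exact tendsto_const_nhds
  · filter_upwards [hnorm, hP.coeFn_toLp] with t h1 h2
    rw [h2, h1]
  · rw [fourierCoeff_congr_ae hP.coeFn_toLp]
    have h1 := hlim 0
    simp only [fourierCoeff_zero_exp (hQtop _) (nonnegSpectrum_analyticCompletion (Q _))] at h1
    have hQ0 : Filter.Tendsto (fun k => fourierCoeff (Q k) 0) Filter.atTop
        (nhds (fourierCoeff Ψ 0)) := by
      simp only [fourierCoeff_eq_repr, HilbertBasis.repr_apply_apply]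
      exact tendsto_const_nhds.inner hQΨ
    have hΨ0 : fourierCoeff Ψ 0 = ((∫ t, ψ t ∂circleMeasure : ℝ) : ℂ) := by
      rw [fourierCoeff_congr_ae hΨe, fourierCoeff, ← integral_complex_ofReal]
      simp
    have h2 := (Complex.continuous_exp.tendsto _).comp (hQ0.comp hmono.tendsto_atTop)
    rw [hΨ0, ← Complex.ofReal_exp] at h2
    refine tendsto_nhds_unique h1 (h2.congr fun k => ?_)
    simp [fourierCoeff_analyticCompletion]

/-! ### Division by outer functions -/

theorem exists_ae_norm_le (u : Linf) : ∃ C : ℝ, 1 ≤ C ∧ ∀ᵐ t ∂circleMeasure, ‖u t‖ ≤ C :=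
  ⟨max 1 (eLpNorm u ∞ circleMeasure).toReal, le_max_left _ _,
    (ae_norm_le_of_memLp_top (Lp.memLp u)).mono fun _ ht => ht.trans (le_max_right _ _)⟩

theorem aestronglyMeasurable_log_max (u : Linf) (δ : ℝ) :
    AEStronglyMeasurable (fun t => Real.log (max ‖u t‖ δ)) circleMeasure :=
  (Real.measurable_log.comp_aemeasurable
    ((Lp.aestronglyMeasurable u).norm.aemeasurable.max aemeasurable_const)).aestronglyMeasurable

theorem exists_abs_log_max_le (u : Linf) {δ : ℝ} (hδ : 0 < δ) :
    ∃ M : ℝ, ∀ᵐ t ∂circleMeasure, |Real.log (max ‖u t‖ δ)| ≤ M := by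
  obtain ⟨C, hC1, hC⟩ := exists_ae_norm_le u
  refine ⟨max (Real.log (max C δ)) (-Real.log δ), hC.mono fun t ht => abs_le'.2 ⟨?_, ?_⟩⟩
  · exact (Real.log_le_log (hδ.trans_le (le_max_right _ _)) (by gcongr)).trans (le_max_left _ _)
  · exact (neg_le_neg (Real.log_le_log hδ (le_max_right _ _))).trans (le_max_right _ _)

/-- A bounded analytic function of modulus `1 / max(|u|, δ)` normalises `u` to the unit ball. -/
theorem exists_mem_Hinf_mul_norm_le_one {u : Linf} (hu : u ∈ Hinf) {δ : ℝ} (hδ : 0 < δ) :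
    ∃ p ∈ Hinf, (∀ᵐ t ∂circleMeasure, ‖p t * u t‖ ≤ 1) ∧
      fourierCoeff (fun t => p t * u t) 0 =
        (Real.exp (-∫ t, Real.log (max ‖u t‖ δ) ∂circleMeasure) : ℂ) * fourierCoeff u 0 := by
  obtain ⟨M, hM⟩ := exists_abs_log_max_le u hδ
  obtain ⟨p, hp, hpn, hp0⟩ := exists_mem_Hinf_norm_eq_exp (aestronglyMeasurable_log_max u δ).neg
    (M := M) (hM.mono fun t ht => by simpa using ht)
  refine ⟨p, hp, ?_, ?_⟩
  · filter_upwards [hpn] with t ht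
    have hpos : 0 < max ‖u t‖ δ := hδ.trans_le (le_max_right _ _)
    rw [norm_mul, ht, Pi.neg_apply, Real.exp_neg, Real.exp_log hpos, inv_mul_le_iff₀ hpos, mul_one]
    exact le_max_left _ _
  · rw [fourierCoeff_zero_mul (memLp_two p) (memLp_two u) hp hu, hp0]
    simp only [Pi.neg_apply, integral_neg]

theorem norm_fourierCoeff_zero_le_one {v : UnitAddCircle → ℂ}
    (hv : ∀ᵐ t ∂circleMeasure, ‖v t‖ ≤ 1) : ‖fourierCoeff v 0‖ ≤ 1 := by
  refine (norm_integral_le_of_norm_le_const (C := 1) ?_).trans (by simp)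
  simpa using hv

/-- Jensen's inequality for the value at the origin. -/
theorem log_norm_fourierCoeff_zero_le {u : Linf} (hu : u ∈ Hinf) (h0 : fourierCoeff u 0 ≠ 0)
    {δ : ℝ} (hδ : 0 < δ) :
    Real.log ‖fourierCoeff u 0‖ ≤ ∫ t, Real.log (max ‖u t‖ δ) ∂circleMeasure := by
  obtain ⟨p, -, hp1, hp0⟩ := exists_mem_Hinf_mul_norm_le_one hu hδ
  have h := norm_fourierCoeff_zero_le_one hp1
  rw [hp0, norm_mul, Complex.norm_real, Real.norm_eq_abs, Real.abs_exp, Real.exp_neg,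
    inv_mul_le_iff₀ (Real.exp_pos _), mul_one] at h
  exact (Real.log_le_iff_le_exp (norm_pos_iff.2 h0)).2 h

/-- A function in `H^∞` not vanishing at the origin is nonzero almost everywhere: otherwise the
right-hand side of Jensen's inequality tends to `-∞` with `δ`. -/
theorem ae_ne_zero_of_fourierCoeff_zero_ne {u : Linf} (hu : u ∈ Hinf)
    (h0 : fourierCoeff u 0 ≠ 0) : ∀ᵐ t ∂circleMeasure, u t ≠ 0 := by
  obtain ⟨C, hC1, hC⟩ := exists_ae_norm_le u
  have hum := (Lp.stronglyMeasurable u).measurable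
  set E : Set UnitAddCircle := {t | u t = 0} with hE
  have hEm : MeasurableSet E := hum (measurableSet_singleton 0)
  have key (n : ℕ) :
      Real.log ‖fourierCoeff u 0‖ ≤ Real.log C - n * circleMeasure.real E := by
    refine (log_norm_fourierCoeff_zero_le hu h0 (Real.exp_pos (-n))).trans ?_
    have e : Real.log C - n * circleMeasure.real E =
        ∫ t, (Real.log C - E.indicator (fun _ => (n : ℝ)) t) ∂circleMeasure := by
      rw [integral_sub (integrable_const _) ((integrable_const _).indicator hEm),
        integral_indicator_const _ hEm]
      simp [mul_comm]
    rw [e]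
    obtain ⟨M, hM⟩ := exists_abs_log_max_le u (Real.exp_pos (-n : ℝ))
    refine integral_mono_ae ?_ ((integrable_const _).sub ((integrable_const _).indicator hEm)) ?_
    · exact (memLp_top_of_bound (aestronglyMeasurable_log_max u _) M hM).integrable le_top
    filter_upwards [hC] with t ht
    by_cases ht0 : u t = 0
    · have : t ∈ E := ht0
      simp only [Set.indicator_of_mem this, ht0, norm_zero]
      rw [max_eq_right (Real.exp_pos _).le, Real.log_exp]
      linarith [Real.log_nonneg hC1]
    · have : t ∉ E := ht0
      simp only [Set.indicator_of_notMem this, sub_zero]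
      refine Real.log_le_log ((Real.exp_pos _).trans_le (le_max_right _ _)) (max_le ht ?_)
      exact (Real.exp_le_one_iff.2 (by simp)).trans hC1
  have hE0 : circleMeasure.real E = 0 := by
    by_contra hne
    have hpos : 0 < circleMeasure.real E := lt_of_le_of_ne measureReal_nonneg (Ne.symm hne)
    obtain ⟨n, hn⟩ := exists_nat_gt
      ((Real.log C - Real.log ‖fourierCoeff u 0‖) / circleMeasure.real E)
    rw [div_lt_iff₀ hpos] at hn
    linarith [key n]
  rw [measureReal_eq_zero_iff] at hE0
  exact measure_eq_zero_iff_ae_notMem.1 hE0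

theorem tendsto_integral_log_max {u : Linf} (hu0 : ∀ᵐ t ∂circleMeasure, u t ≠ 0)
    (hi : Integrable (fun t => Real.log ‖u t‖) circleMeasure) :
    Filter.Tendsto (fun n : ℕ => ∫ t, Real.log (max ‖u t‖ (1 / ((n : ℝ) + 1))) ∂circleMeasure)
      Filter.atTop (nhds (∫ t, Real.log ‖u t‖ ∂circleMeasure)) := by
  refine tendsto_integral_of_dominated_convergence (fun t => |Real.log ‖u t‖|)
    (fun n => aestronglyMeasurable_log_max u _) hi.abs (fun n => ?_) ?_
  · filter_upwards [hu0] with t ht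
    have hpos := norm_pos_iff.2 ht
    have hδ : 0 < 1 / ((n : ℝ) + 1) := by positivity
    have hδ1 : 1 / ((n : ℝ) + 1) ≤ 1 := (div_le_one (by positivity)).2 (by simp)
    rw [Real.norm_eq_abs]
    rcases le_total (1 / ((n : ℝ) + 1)) ‖u t‖ with h | h
    · rw [max_eq_left h]
    · rw [max_eq_right h, abs_of_nonpos (Real.log_nonpos hδ.le hδ1),
        abs_of_nonpos (Real.log_nonpos hpos.le (h.trans hδ1))]
      exact neg_le_neg (Real.log_le_log hpos h)
  · filter_upwards [hu0] with t ht
    have hpos := norm_pos_iff.2 ht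
    have h1 : Filter.Tendsto (fun n : ℕ => max ‖u t‖ (1 / ((n : ℝ) + 1))) Filter.atTop
        (nhds (max ‖u t‖ 0)) :=
      tendsto_const_nhds.max tendsto_one_div_add_atTop_nhds_zero_nat
    rw [max_eq_left hpos.le] at h1
    exact (Real.continuousAt_log hpos.ne').tendsto.comp h1

/-- The defining formula at the origin: the modulus of `u(0)` is the geometric mean of `|u|`. -/
theorem IsOuter.norm_fourierCoeff_zero {u : Linf} (hu : IsOuter u) :
    ‖fourierCoeff u 0‖ = Real.exp (∫ t, Real.log ‖u t‖ ∂circleMeasure) := by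
  obtain ⟨-, -, c, hc, h⟩ := hu
  have h1 := h 0 (by simp)
  have h2 : discExt u 0 = fourierCoeff u 0 := by
    rw [discExt, tsum_eq_single 0 (fun n hn => by simp [hn])]
    simp
  have h3 (t : UnitAddCircle) : (fourier 1 t + 0) / (fourier 1 t - 0) * (Real.log ‖u t‖ : ℂ) =
      (Real.log ‖u t‖ : ℂ) := by
    rw [add_zero, sub_zero, div_self, one_mul]
    rw [fourier_apply]
    exact Circle.coe_ne_zero _
  simp only [h3] at h1
  rw [← h2, h1, norm_mul, hc, one_mul, Complex.norm_exp, integral_complex_ofReal, Complex.ofReal_re]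

/-- Integrability of `Real.log ‖u‖` does not by itself exclude zeros, as `Real.log 0 = 0`. -/
theorem IsOuter.ae_ne_zero {u : Linf} (hu : IsOuter u) : ∀ᵐ t ∂circleMeasure, u t ≠ 0 :=
  ae_ne_zero_of_fourierCoeff_zero_ne hu.1 fun h => by
    have := hu.norm_fourierCoeff_zero
    rw [h, norm_zero] at this
    exact (Real.exp_pos _).ne this

/-- For outer `u`, a unimodular constant is the limit in `L²` of multiples `p u` in the unit ball
of `H^∞`. -/
theorem IsOuter.exists_mul_tendsto {u : Linf} (hu : IsOuter u) :
    ∃ c : ℂ, ‖c‖ = 1 ∧ ∃ p : ℕ → Linf, (∀ n, p n ∈ Hinf) ∧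
      Filter.Tendsto (fun n => ∫ t, ‖p n t * u t - c‖ ^ 2 ∂circleMeasure) Filter.atTop
        (nhds 0) := by
  have h0 := hu.norm_fourierCoeff_zero
  set L := ∫ t, Real.log ‖u t‖ ∂circleMeasure
  choose p hp hp1 hp0 using fun n : ℕ =>
    exists_mem_Hinf_mul_norm_le_one hu.1 (δ := 1 / ((n : ℝ) + 1)) (by positivity)
  set c : ℂ := fourierCoeff u 0 / (Real.exp L : ℂ) with hc
  have hc1 : ‖c‖ = 1 := by
    rw [hc, norm_div, h0, Complex.norm_real, Real.norm_eq_abs, Real.abs_exp,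
      div_self (Real.exp_pos _).ne']
  have hcu : fourierCoeff u 0 = c * (Real.exp L : ℂ) := by
    rw [hc, div_mul_cancel₀]
    exact_mod_cast (Real.exp_pos L).ne'
  have hcc : star c * c = 1 := by
    rw [RCLike.star_def, ← Complex.normSq_eq_conj_mul_self, Complex.normSq_eq_norm_sq, hc1]
    simp
  refine ⟨c, hc1, p, hp, ?_⟩
  have hb (n : ℕ) := integral_norm_sub_sq_le (v := fun t => p n t * u t)
    ((Lp.aestronglyMeasurable (p n)).mul (Lp.aestronglyMeasurable u)) (hp1 n) c
  have hval (n : ℕ) : (star c * fourierCoeff (fun t => p n t * u t) 0).re =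
      Real.exp (-∫ t, Real.log (max ‖u t‖ (1 / ((n : ℝ) + 1))) ∂circleMeasure) * Real.exp L := by
    have e : star c * fourierCoeff (fun t => p n t * u t) 0 =
        ((Real.exp (-∫ t, Real.log (max ‖u t‖ (1 / ((n : ℝ) + 1))) ∂circleMeasure) *
          Real.exp L : ℝ) : ℂ) := by
      rw [hp0, hcu, Complex.ofReal_mul]
      linear_combination ((Real.exp (-∫ t, Real.log (max ‖u t‖ (1 / ((n : ℝ) + 1)))
        ∂circleMeasure) : ℂ) * (Real.exp L : ℂ)) * hcc
    rw [e, Complex.ofReal_re]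
  simp only [hval, hc1] at hb
  have ht := ((Real.continuous_exp.tendsto _).comp
    (tendsto_integral_log_max hu.ae_ne_zero hu.2.1).neg).mul_const (Real.exp L)
  have ht' := (tendsto_const_nhds (x := (1 + 1 ^ 2 : ℝ))).sub (ht.const_mul 2)
  rw [← Real.exp_add, neg_add_cancel, Real.exp_zero] at ht'
  norm_num at ht'
  norm_num at hb
  exact squeeze_zero (fun n => integral_nonneg fun t => by positivity) hb
    (by simpa [Function.comp_def] using ht')

theorem norm_fourierCoeff_mul_le {w f : UnitAddCircle → ℂ} (hw : MemLp w 2 circleMeasure)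
    (hf : MemLp f 2 circleMeasure) (n : ℤ) :
    ‖fourierCoeff (fun t => w t * f t) n‖ ≤
      √(∫ t, ‖w t‖ ^ 2 ∂circleMeasure) * √(∫ t, ‖f t‖ ^ 2 ∂circleMeasure) := by
  have h2 : ENNReal.ofReal 2 = 2 := by norm_num
  have key := integral_mul_norm_le_Lp_mul_Lq (μ := circleMeasure) (f := w) (g := f)
    (Real.HolderConjugate.two_two) (by rwa [h2]) (by rwa [h2])
  simp only [Real.rpow_two, ← Real.sqrt_eq_rpow] at key
  refine (norm_integral_le_integral_norm _).trans (le_of_eq_of_le ?_ key)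
  refine integral_congr_ae (.of_forall fun t => ?_)
  simp only [norm_smul, norm_mul, fourier_apply, Circle.norm_coe, one_mul]

/-- Division by the conjugate of an outer function preserves `H²₋` within `L²`. -/
theorem mem_H2_orthogonal_of_outer {h : Linf} (hh : IsOuter (star h)) {φ : L2}
    (hφ : mulOp h φ ∈ H2ᗮ) : φ ∈ H2ᗮ := by
  obtain ⟨c, hc, p, hp, hlim⟩ := hh.exists_mul_tendsto
  rw [mem_H2_orthogonal_iff] at hφ ⊢
  intro k hk
  have hw (n : ℕ) : MemLp (fun t => p n t * (star h : Linf) t - c) 2 circleMeasure :=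
    ((memLp_two (star h)).mul' (Lp.memLp (p n))).sub (memLp_const c)
  -- The coefficient of `conj (p u) φ` vanishes, so that of `conj c φ` is a coefficient of
  -- `conj (c - p u) φ`.
  have hcoef (n : ℕ) :
      fourierCoeff (fun t => star (p n t * (star h : Linf) t - c) * φ t) k =
        -(star c * fourierCoeff φ k) := by
    have h1 : fourierCoeff (fun t => star (p n t) * mulOp h φ t) k = 0 :=
      NegSpectrum.star_mul (memLp_two (p n)) (Lp.memLp (mulOp h φ)) (hp n) hφ k hk
    have hi1 : Integrable (fun t => star (p n t) * mulOp h φ t) circleMeasure :=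
      (memLp_two (p n)).star.integrable_mul (Lp.memLp (mulOp h φ))
    have hi2 : Integrable (fun t => -star c * φ t) circleMeasure :=
      ((Lp.memLp φ).integrable (by norm_num)).const_mul _
    have h2 := congrFun (fourierCoeff.add hi1 hi2) k
    rw [Pi.add_apply, h1, zero_add, fourierCoeff.const_mul, neg_mul] at h2
    rw [← h2]
    refine congrFun (fourierCoeff_congr_ae ?_) k
    filter_upwards [coeFn_mulOp h φ, Lp.coeFn_star h] with t e1 e2
    rw [Pi.add_apply, e1, e2, Pi.star_apply, star_sub, star_mul', star_star]
    ring
  have hle (n : ℕ) : ‖fourierCoeff φ k‖ ≤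
      √(∫ t, ‖p n t * (star h : Linf) t - c‖ ^ 2 ∂circleMeasure) *
        √(∫ t, ‖φ t‖ ^ 2 ∂circleMeasure) := by
    have := norm_fourierCoeff_mul_le (hw n).star (Lp.memLp φ) k
    simp only [Pi.star_apply, norm_star] at this
    rwa [hcoef n, norm_neg, norm_mul, norm_star, hc, one_mul] at this
  have ht := (hlim.sqrt).mul_const (√(∫ t, ‖φ t‖ ^ 2 ∂circleMeasure))
  rw [Real.sqrt_zero, zero_mul] at ht
  exact norm_le_zero_iff.1 (ge_of_tendsto' ht hle)

theorem outer_conj_ae_ne_zero {h : Linf} (hh : IsOuter (star h)) :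
    ∀ᵐ t ∂circleMeasure, h t ≠ 0 := by
  filter_upwards [hh.ae_ne_zero, Lp.coeFn_star h] with t h1 h2 h3
  rw [h2, Pi.star_apply, h3, star_zero] at h1
  exact h1 rfl

/-- The partner of `f` for the symbol `b h` is `-(a / (b h)) f`, which is in `L²` because the
quotient is bounded. -/
theorem projKerPlus_le_mulInf_right_of_outer {a b h : Linf}
    (hb : ∀ᵐ t ∂circleMeasure, b t ≠ 0) (hh : IsOuter (star h))
    (hq : MemLp (fun t => a t / (b t * h t)) ∞ circleMeasure) :
    projKerPlus a b ≤ projKerPlus a (mulInf b h) := by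
  intro f hf
  obtain ⟨hf, g, hg, e⟩ := mem_projKerPlus.1 hf
  have e1 : ∀ᵐ t ∂circleMeasure,
      a t * f t + b t * (h t * mulOp (-hq.toLp) f t) = 0 ∧ h t * mulOp (-hq.toLp) f t = g t := by
    filter_upwards [e, hb, outer_conj_ae_ne_zero hh, coeFn_mulOp (-hq.toLp) f,
      Lp.coeFn_neg hq.toLp, hq.coeFn_toLp] with t h1 h2 h3 h4 h5 h6
    have h7 : h t * mulOp (-hq.toLp) f t = g t := by
      rw [h4, h5, Pi.neg_apply, h6]
      field_simp
      linear_combination -h1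
    exact ⟨by rw [h7, h1], h7⟩
  refine mem_projKerPlus.2 ⟨hf, mulOp (-hq.toLp) f, mem_H2_orthogonal_of_outer hh ?_, ?_⟩
  · convert hg using 1
    refine Lp.ext ?_
    filter_upwards [e1, coeFn_mulOp h (mulOp (-hq.toLp) f)] with t h1 h2
    rw [h2, h1.2]
  · filter_upwards [e1, coeFn_mulInf b h] with t h1 h2
    rw [h2, mul_assoc, h1.1]

theorem projKerPlus_mulInf_left_le_of_outer {a b h : Linf}
    (hb : ∀ᵐ t ∂circleMeasure, b t ≠ 0) (hh : IsOuter (star h))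
    (hq : MemLp (fun t => a t / b t) ∞ circleMeasure) :
    projKerPlus (mulInf a h) b ≤ projKerPlus a b := by
  intro f hf
  obtain ⟨hf, g, hg, e⟩ := mem_projKerPlus.1 hf
  have e1 : ∀ᵐ t ∂circleMeasure,
      a t * f t + b t * mulOp (-hq.toLp) f t = 0 ∧ h t * mulOp (-hq.toLp) f t = g t := by
    filter_upwards [e, hb, coeFn_mulOp (-hq.toLp) f, Lp.coeFn_neg hq.toLp, hq.coeFn_toLp,
      coeFn_mulInf a h] with t h1 h2 h4 h5 h6 h7
    rw [h7] at h1
    rw [h4, h5, Pi.neg_apply, h6]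
    constructor
    · field_simp
      ring
    · field_simp
      linear_combination -h1
  refine mem_projKerPlus.2 ⟨hf, mulOp (-hq.toLp) f, mem_H2_orthogonal_of_outer hh ?_, ?_⟩
  · convert hg using 1
    refine Lp.ext ?_
    filter_upwards [e1, coeFn_mulOp h (mulOp (-hq.toLp) f)] with t h1 h2
    rw [h2, h1.2]
  · exact e1.mono fun t ht => ht.1

end PairedKernel

end

open PairedKernel in
theorem proposition6p1 (a b h : Linf) (hab : Nondegenerate a b) (hh : star h ∈ Hinf) :
    (projKerPlus a (mulInf b h) ≤ projKerPlus a b ∧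
      projKerPlus a b ≤ projKerPlus (mulInf a h) b) ∧
    (IsOuter (star h) →
      (MemLp (fun t => a t / (b t * h t)) ∞ circleMeasure →
        projKerPlus a (mulInf b h) = projKerPlus a b) ∧
      (MemLp (fun t => a t / b t) ∞ circleMeasure →
        projKerPlus (mulInf a h) b = projKerPlus a b)) ∧
    (HasNonconstInnerFactor (star h) →
      (projKerPlus a b ≠ ⊥ → projKerPlus a (mulInf b h) < projKerPlus a b) ∧
      (projKerPlus (mulInf a h) b ≠ ⊥ → projKerPlus a b < projKerPlus (mulInf a h) b)) := by
  have h1 := projKerPlus_mulInf_right_le a b hh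
  have h2 := projKerPlus_le_mulInf_left a b hh
  refine ⟨⟨h1, h2⟩, fun ho => ⟨fun hq => ?_, fun hq => ?_⟩, fun hI => ⟨fun hne => ?_, fun hne => ?_⟩⟩
  · exact le_antisymm h1 (projKerPlus_le_mulInf_right_of_outer hab.2.1 ho hq)
  · exact le_antisymm (projKerPlus_mulInf_left_le_of_outer hab.2.1 ho hq) h2
  · exact lt_of_le_of_ne h1 (projKerPlus_mulInf_right_ne hab.1 hab.2.1 hI hne)
  · exact lt_of_le_of_ne h2 (ne_projKerPlus_mulInf_left hab.1 hab.2.1 hI hne)
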